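/- Let $\mathbb{H}$ be the skew field of quaternions with its Euclidean norm $|\cdot|$, let $\mathbb{S}=\{I\in\mathbb{H}: I^2=-1\}$ and, for $I\in\mathbb{S}$, let $L_I=\mathbb{R}+I\mathbb{R}$. Let $\Omega\subseteq\mathbb{H}$ be a domain (a nonempty connected open set for the Euclidean topology) and let $f:\Omega\to\mathbb{H}$ be a function. Then $f$ is slice regular on $\Omega$ if and only if $f$ is $\sigma$-analytic on $\Omega$, where these notions are defined as follows. The function $f$ is \emph{slice regular} if for every $I\in\mathbb{S}$ its restriction $f_I$ to $\Omega\cap L_I$ is holomorphic, i.e. $(x,y)\mapsto f(x+Iy)$ is real differentiable and satisfies $\frac12\left(\frac{\partial}{\partial x}+I\frac{\partial}{\partial y}\right)f_I(x+Iy)=0$ at all real $x,y$ with $x+Iy\in\Omega$. For $p,q\in\mathbb{H}$ put $\sigma(q,p)=|q-p|$ if $p$ and $q$ lie on a common complex line $L_I$, and $\sigma(q,p)=\sqrt{(\mathrm{Re}(q)-\mathrm{Re}(p))^2+(|\mathrm{Im}(q)|+|\mathrm{Im}(p)|)^2}$ otherwise; put $\Sigma(p,R)=\{q\in\mathbb{H}:\sigma(q,p)<R\}$.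 Let $(q-p)^{*n}$ denote the value at $q$ of the $n$-th power of the polynomial $q-p$ with respect to the regular multiplication of polynomials with coefficients on the right, $\left(\sum_n q^n a_n\right)*\left(\sum_n q^n b_n\right)=\sum_n q^n\sum_{k=0}^n a_k b_{n-k}$. The function $f$ is \emph{$\sigma$-analytic} on $\Omega$ if for every $p\in\Omega$ there exist a sequence $(a_n)_{n\in\mathbb{N}}$ in $\mathbb{H}$ and $R>0$ such that, for every $q\in\Sigma(p,R)\cap\Omega$, the series $\sum_{n\in\mathbb{N}}(q-p)^{*n}a_n$ converges in the Euclidean norm and its sum is $f(q)$. -/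

import Mathlib

open scoped Quaternion

noncomputable section

namespace SliceRegular

/-- The sphere of quaternionic imaginary units `I` (those with `I ^ 2 = -1`). -/
def imagUnits : Set ℍ[ℝ] := {I | I ^ 2 = -1}

/-- The point `x + I y`, where the parameter `z = x + i y` ranges over the complex plane. -/
def slicePoint (I : ℍ[ℝ]) (z : ℂ) : ℍ[ℝ] := (z.re : ℍ[ℝ]) + I * (z.im : ℍ[ℝ])

/-- The complex line `L_I = ℝ + I ℝ`. -/
def sliceLine (I : ℍ[ℝ]) : Set ℍ[ℝ] := Set.range (slicePoint I)

/-- The restriction of `f` to the complex line `L_I`, read in the coordinate `z = x + i y`. -/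
def sliceRestrict (f : ℍ[ℝ] → ℍ[ℝ]) (I : ℍ[ℝ]) : ℂ → ℍ[ℝ] := fun z => f (slicePoint I z)

/-- The Cauchy-Riemann operator `(1 / 2) (∂/∂x + I ∂/∂y)` applied to the restriction of `f`
to `L_I`; the directions `1` and `Complex.I` of the parameter plane are those of `x` and `y`. -/
def dbar (f : ℍ[ℝ] → ℍ[ℝ]) (I : ℍ[ℝ]) (z : ℂ) : ℍ[ℝ] :=
  (1 / 2 : ℝ) • (fderiv ℝ (sliceRestrict f I) z 1 +
    I * fderiv ℝ (sliceRestrict f I) z Complex.I)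

/-- `f` is slice regular on the open set `Ω`: for every imaginary unit `I`, the restriction of `f`
to `Ω ∩ L_I` is holomorphic, that is, real differentiable and annihilated by `dbar`.
Only the values of `f` on `Ω` matter, since `Ω` is open. -/
def IsSliceRegularOn (f : ℍ[ℝ] → ℍ[ℝ]) (Ω : Set ℍ[ℝ]) : Prop :=
  ∀ I ∈ imagUnits, ∀ z : ℂ, slicePoint I z ∈ Ω →
    DifferentiableAt ℝ (sliceRestrict f I) z ∧ dbar f I z = 0

/-- `p` and `q` lie on a common complex line `L_I`. -/
def SameLine (q p : ℍ[ℝ]) : Prop := ∃ I ∈ imagUnits, q ∈ sliceLine I ∧ p ∈ sliceLine I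

/-- The function `ω(q, p)`. -/
def omega (q p : ℍ[ℝ]) : ℝ := √((q.re - p.re) ^ 2 + (‖q.im‖ + ‖p.im‖) ^ 2)

open Classical in
/-- The distance `σ(q, p)`. -/
def sigma (q p : ℍ[ℝ]) : ℝ := if SameLine q p then ‖q - p‖ else omega q p

/-- The `σ`-ball of center `p` and radius `R`. -/
def sigmaBall (p : ℍ[ℝ]) (R : ℝ) : Set ℍ[ℝ] := {q | sigma q p < R}

/-- The value `∑ qⁿ aₙ` at `q` of the regular polynomial with coefficients `aₙ`, which are
written on the right. -/
def evalRight (q : ℍ[ℝ]) (P : Polynomial ℍ[ℝ]) : ℍ[ℝ] := P.sum fun n a => q ^ n * a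

/-- The value at `q` of the regular power `(q - p)^{*n}`. The product of `Polynomial ℍ[ℝ]`, whose
`n`-th coefficient is `∑ₖ aₖ bₙ₋ₖ`, is the regular product `*`. -/
def regularPow (q p : ℍ[ℝ]) (n : ℕ) : ℍ[ℝ] :=
  evalRight q ((Polynomial.X - Polynomial.C p) ^ n)

/-- The series `∑ (q - p)^{*n} aₙ` converges at `q`, in the Euclidean norm, with sum `s`. -/
def RegularSeriesConvergesTo (a : ℕ → ℍ[ℝ]) (p q s : ℍ[ℝ]) : Prop :=
  Filter.Tendsto (fun N : ℕ => ∑ n ∈ Finset.range N, regularPow q p n * a n)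
    Filter.atTop (nhds s)

/-- `f`, defined on `Ω`, is `σ`-analytic at `p`. -/
def IsSigmaAnalyticAt (f : ℍ[ℝ] → ℍ[ℝ]) (Ω : Set ℍ[ℝ]) (p : ℍ[ℝ]) : Prop :=
  ∃ a : ℕ → ℍ[ℝ], ∃ R : ℝ, 0 < R ∧
    ∀ q ∈ sigmaBall p R ∩ Ω, RegularSeriesConvergesTo a p q (f q)

/-- `f` is `σ`-analytic on `Ω`. -/
def IsSigmaAnalyticOn (f : ℍ[ℝ] → ℍ[ℝ]) (Ω : Set ℍ[ℝ]) : Prop :=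
  ∀ p ∈ Ω, IsSigmaAnalyticAt f Ω p

end SliceRegular

end

open Filter Topology Quaternion

/-! For each unit `I`, left multiplication by `L_I` makes `ℍ` a complex Banach space, and slice
regularity says exactly that each `sliceRestrict f I` is complex differentiable for it
(`differentiableAt_slice_iff`). Points of one line commute, so there regular powers are ordinary
powers and complex power series theory applies in both directions. For the expansion at a nonreal
`p`, a small σ-ball lies in the single line through `p`. At a real `p` it meets every line, and the
expansions on different lines share their coefficients because they agree on the real axis
(`coeff_eq_of_tendsto_real`). -/

/-- If the partial sums of a power series converge pointwise on a ball, then the limit has that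
power series expansion at the centre. -/
theorem hasFPowerSeriesAt_of_tendsto_partialSum {𝕜 E : Type*} [NontriviallyNormedField 𝕜]
    [NormedAddCommGroup E] [NormedSpace 𝕜 E] [CompleteSpace E] {g : 𝕜 → E} {a : ℕ → E} {c : 𝕜}
    {R : ℝ} (hR : 0 < R)
    (h : ∀ z ∈ Metric.ball c R,
      Tendsto (fun N : ℕ => ∑ n ∈ Finset.range N, (z - c) ^ n • a n) atTop (𝓝 (g z))) :
    HasFPowerSeriesAt g (fun n => ContinuousMultilinearMap.mkPiRing 𝕜 (Fin n) (a n)) c := by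
  set p : FormalMultilinearSeries 𝕜 𝕜 E :=
    fun n => ContinuousMultilinearMap.mkPiRing 𝕜 (Fin n) (a n)
  have hcoeff : ∀ n, p.coeff n = a n := fun n => by simp [p, FormalMultilinearSeries.coeff]
  obtain ⟨y, hy0, hyR⟩ := NormedField.exists_norm_lt 𝕜 hR
  have hterm : Tendsto (fun n => y ^ n • a n) atTop (𝓝 0) := by
    have h1 := h (y + c) (by simpa using hyR)
    simp only [add_sub_cancel_right] at h1
    have h2 := (h1.comp (tendsto_add_atTop_nat 1)).sub h1
    simpa [Function.comp_def, Finset.sum_range_succ] using h2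
  -- Convergence is only assumed for ordered partial sums; terms tending to zero at one `y ≠ 0`
  -- already force a positive radius.
  have hrad : (‖y‖₊ : ENNReal) ≤ p.radius := by
    refine p.le_radius_of_tendsto (l := 0) ?_
    refine hterm.norm.congr' (Eventually.of_forall fun n => ?_) |>.trans (by simp)
    simp [p, norm_smul, mul_comm]
  have hpos : 0 < p.radius := lt_of_lt_of_le (by simpa using hy0) hrad
  rw [hasFPowerSeriesAt_iff']
  filter_upwards [Metric.ball_mem_nhds c hR, Metric.eball_mem_nhds c hpos] with z hz hz'
  have hs : HasSum (fun n => (z - c) ^ n • a n) (p.sum (z - c)) := by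
    have := p.hasSum (x := z - c) (by simpa [edist_eq_enorm_sub] using hz')
    simpa [hcoeff] using this
  have := tendsto_nhds_unique hs.tendsto_sum_nat (h z hz)
  simpa [hcoeff, this] using hs

/-- The Cauchy-Riemann criterion for a complex normed space whose real structure need not be
definitionally the restriction of the complex one. -/
theorem differentiableAt_complex_iff_of_isScalarTower {E : Type*} [NormedAddCommGroup E]
    [NormedSpace ℂ E] [NormedSpace ℝ E] [IsScalarTower ℝ ℂ E] {f : ℂ → E} {z : ℂ} :
    DifferentiableAt ℂ f z ↔
      DifferentiableAt ℝ f z ∧ fderiv ℝ f z Complex.I = Complex.I • fderiv ℝ f z 1 := by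
  constructor
  · intro h
    refine ⟨h.restrictScalars ℝ, ?_⟩
    rw [h.fderiv_restrictScalars ℝ, ContinuousLinearMap.coe_restrictScalars', ← map_smul]
    simp
  · rintro ⟨h, hI⟩
    refine (differentiableAt_iff_restrictScalars ℝ h).2
      ⟨ContinuousLinearMap.toSpanSingleton ℂ (fderiv ℝ f z 1), ?_⟩
    ext w
    have hw : w = w.re • (1 : ℂ) + w.im • Complex.I := by
      simp [Complex.re_add_im]
    rw [ContinuousLinearMap.coe_restrictScalars', ContinuousLinearMap.toSpanSingleton_apply]
    conv_rhs => rw [hw, map_add, map_smul, map_smul, hI]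
    conv_lhs => rw [hw, add_smul, smul_assoc, smul_assoc, one_smul]

namespace SliceRegular

theorem evalRight_add (q : ℍ[ℝ]) (P Q : Polynomial ℍ[ℝ]) :
    evalRight q (P + Q) = evalRight q P + evalRight q Q :=
  Polynomial.sum_add_index P Q _ (by simp) (by simp [mul_add])

theorem evalRight_monomial (q : ℍ[ℝ]) (n : ℕ) (a : ℍ[ℝ]) :
    evalRight q (Polynomial.monomial n a) = q ^ n * a :=
  Polynomial.sum_monomial_index a _ (by simp)

/-- Coefficients stand on the right, so the factor `X` multiplies values by `q` on the left, while
the constant `p` multiplies them on the right. -/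
theorem evalRight_mul_X_sub_C (q p : ℍ[ℝ]) (P : Polynomial ℍ[ℝ]) :
    evalRight q (P * (Polynomial.X - Polynomial.C p)) =
      q * evalRight q P - evalRight q P * p := by
  induction P using Polynomial.induction_on' with
  | add P Q hP hQ => rw [add_mul, evalRight_add, hP, hQ, evalRight_add]; noncomm_ring
  | monomial n a =>
    rw [sub_eq_add_neg, mul_add, Polynomial.monomial_mul_X, ← Polynomial.C_neg,
      Polynomial.monomial_mul_C, evalRight_add, evalRight_monomial, evalRight_monomial,
      evalRight_monomial, pow_succ']
    noncomm_ring

theorem regularPow_eq_pow {q p : ℍ[ℝ]} (h : Commute q p) (n : ℕ) :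
    regularPow q p n = (q - p) ^ n := by
  induction n with
  | zero => 
    rw [regularPow, pow_zero, ← Polynomial.monomial_zero_one, evalRight_monomial]
    simp
  | succ n ih =>
    rw [regularPow] at ih ⊢
    have hc : Commute ((q - p) ^ n) p := (h.sub_left (Commute.refl p)).pow_left n
    rw [pow_succ, evalRight_mul_X_sub_C, ih, hc.eq, ← sub_mul, ← pow_succ']

theorem mul_self_of_mem {I : ℍ[ℝ]} (hI : I ∈ imagUnits) : I * I = -1 := by
  rw [← sq]; exact hI

theorem norm_of_mem {I : ℍ[ℝ]} (hI : I ∈ imagUnits) : ‖I‖ = 1 := by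
  have h : ‖I‖ * ‖I‖ = 1 := by rw [← norm_mul, mul_self_of_mem hI]; simp
  nlinarith [norm_nonneg I]

theorem re_of_mem {I : ℍ[ℝ]} (hI : I ∈ imagUnits) : I.re = 0 := by
  rw [← Quaternion.sq_eq_neg_normSq, Quaternion.normSq_eq_norm_mul_self, norm_of_mem hI]
  have h : I ^ 2 = -1 := hI
  simpa using h

/-- The embedding of `ℂ` onto the complex line `L_I`. -/
noncomputable def sliceHom {I : ℍ[ℝ]} (hI : I ∈ imagUnits) : ℂ →ₐ[ℝ] ℍ[ℝ] :=
  Complex.lift ⟨I, mul_self_of_mem hI⟩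

theorem sliceHom_apply {I : ℍ[ℝ]} (hI : I ∈ imagUnits) (z : ℂ) :
    sliceHom hI z = slicePoint I z := by
  simp only [sliceHom, Complex.lift_apply, Complex.liftAux_apply, slicePoint,
    Quaternion.mul_coe_eq_smul]
  rfl

theorem norm_sliceHom {I : ℍ[ℝ]} (hI : I ∈ imagUnits) (z : ℂ) : ‖sliceHom hI z‖ = ‖z‖ := by
  have h1 : ‖I‖ * ‖I‖ = 1 := by simp [norm_of_mem hI]
  rw [← Quaternion.normSq_eq_norm_mul_self, Quaternion.normSq_def', re_of_mem hI] at h1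
  rw [← sq_eq_sq₀ (norm_nonneg _) (norm_nonneg _), sq, ← Quaternion.normSq_eq_norm_mul_self,
    Complex.sq_norm, Complex.normSq_apply, Quaternion.normSq_def', sliceHom_apply, slicePoint]
  simp only [Quaternion.mul_coe_eq_smul, Quaternion.re_add, Quaternion.imI_add,
    Quaternion.imJ_add, Quaternion.imK_add, Quaternion.re_coe, Quaternion.imI_coe,
    Quaternion.imJ_coe, Quaternion.imK_coe, Quaternion.re_smul, Quaternion.imI_smul,
    Quaternion.imJ_smul, Quaternion.imK_smul, re_of_mem hI, smul_eq_mul]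
  linear_combination z.im ^ 2 * h1

/-- The complex structure on `ℍ` for which `x + i y` acts as left multiplication by `x + I y`. -/
noncomputable abbrev sliceNormedSpace {I : ℍ[ℝ]} (hI : I ∈ imagUnits) : NormedSpace ℂ ℍ[ℝ] where
  toModule := Module.compHom ℍ[ℝ] (sliceHom hI).toRingHom
  norm_smul_le z q := by
    change ‖sliceHom hI z * q‖ ≤ _
    rw [norm_mul, norm_sliceHom]

theorem differentiableAt_slice_iff {I : ℍ[ℝ]} (hI : I ∈ imagUnits) (f : ℍ[ℝ] → ℍ[ℝ]) (z : ℂ) :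
    (letI := sliceNormedSpace hI; DifferentiableAt ℂ (sliceRestrict f I) z) ↔
      DifferentiableAt ℝ (sliceRestrict f I) z ∧ dbar f I z = 0 := by
  let _ := sliceNormedSpace hI
  have : IsScalarTower ℝ ℂ ℍ[ℝ] := ⟨fun r z q => by
    change sliceHom hI (r • z) * q = r • (sliceHom hI z * q)
    rw [map_smul, smul_mul_assoc]⟩
  refine differentiableAt_complex_iff_of_isScalarTower.trans ?_
  refine and_congr_right fun _ => ?_
  have hsmul : ∀ q : ℍ[ℝ], Complex.I • q = I * q := fun q => by
    change sliceHom hI Complex.I * q = I * q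
    simp [sliceHom]
  rw [hsmul, dbar, smul_eq_zero_iff_right (by norm_num)]
  constructor
  · intro h
    rw [h, ← mul_assoc, mul_self_of_mem hI]; simp
  · intro h
    rw [eq_neg_of_add_eq_zero_left h, mul_neg, ← mul_assoc, mul_self_of_mem hI]; simp

theorem exists_hasSum_of_isSliceRegularOn {f : ℍ[ℝ] → ℍ[ℝ]} {Ω : Set ℍ[ℝ]}
    (hf : IsSliceRegularOn f Ω) {I : ℍ[ℝ]} (hI : I ∈ imagUnits) {w : ℂ} {R : ℝ}
    (hR : Metric.ball (slicePoint I w) R ⊆ Ω) :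
    ∃ a : ℕ → ℍ[ℝ], ∀ z ∈ Metric.ball w R,
      HasSum (fun n => (slicePoint I z - slicePoint I w) ^ n * a n) (f (slicePoint I z)) := by
  let _ := sliceNormedSpace hI
  have hd : DifferentiableOn ℂ (sliceRestrict f I) (Metric.ball w R) := fun z hz => by
    refine ((differentiableAt_slice_iff hI f z).2 (hf I hI z (hR ?_))).differentiableWithinAt
    rw [mem_ball_iff_norm, ← sliceHom_apply hI, ← sliceHom_apply hI, ← map_sub, norm_sliceHom]
    exact mem_ball_iff_norm.1 hz
  -- Taylor coefficients; complex scalars act from the left, which leaves them on the right of the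
  -- powers.
  refine ⟨fun n => (n.factorial : ℂ)⁻¹ • iteratedDeriv n (sliceRestrict f I) w, fun z hz => ?_⟩
  refine (Complex.hasSum_taylorSeries_on_ball hd hz).congr fun s => Finset.sum_congr rfl fun n _ => ?_
  beta_reduce
  rw [smul_comm]
  change sliceHom hI ((z - w) ^ n) * _ = _
  rw [map_pow, map_sub, sliceHom_apply, sliceHom_apply]

theorem differentiableAt_slice_of_tendsto {f : ℍ[ℝ] → ℍ[ℝ]} {I : ℍ[ℝ]} (hI : I ∈ imagUnits)
    {w : ℂ} {R : ℝ} (hR : 0 < R) {a : ℕ → ℍ[ℝ]}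
    (h : ∀ z ∈ Metric.ball w R, Tendsto (fun N : ℕ => ∑ n ∈ Finset.range N,
      (slicePoint I z - slicePoint I w) ^ n * a n) atTop (𝓝 (f (slicePoint I z)))) :
    DifferentiableAt ℝ (sliceRestrict f I) w ∧ dbar f I w = 0 := by
  rw [← differentiableAt_slice_iff hI]
  let _ := sliceNormedSpace hI
  refine (hasFPowerSeriesAt_of_tendsto_partialSum (a := a) hR fun z hz => ?_).differentiableAt
  refine (h z hz).congr fun N => Finset.sum_congr rfl fun n _ => ?_
  change _ = sliceHom hI ((z - w) ^ n) * a n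
  rw [map_pow, map_sub, sliceHom_apply, sliceHom_apply]

/-- Two power series that agree near a real point have the same coefficients. -/
theorem coeff_eq_of_tendsto_real {g : ℝ → ℍ[ℝ]} {a b : ℕ → ℍ[ℝ]} {c R : ℝ} (hR : 0 < R)
    (ha : ∀ x ∈ Metric.ball c R,
      Tendsto (fun N : ℕ => ∑ n ∈ Finset.range N, (x - c) ^ n • a n) atTop (𝓝 (g x)))
    (hb : ∀ x ∈ Metric.ball c R,
      Tendsto (fun N : ℕ => ∑ n ∈ Finset.range N, (x - c) ^ n • b n) atTop (𝓝 (g x))) :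
    a = b := by
  have h := (hasFPowerSeriesAt_of_tendsto_partialSum hR ha).eq_formalMultilinearSeries
    (hasFPowerSeriesAt_of_tendsto_partialSum hR hb)
  funext n
  simpa [FormalMultilinearSeries.coeff] using
    congrArg (fun p => FormalMultilinearSeries.coeff p n) h

theorem slicePoint_ofReal (I : ℍ[ℝ]) (x : ℝ) : slicePoint I (x : ℂ) = (x : ℍ[ℝ]) := by
  simp [slicePoint]

theorem commute_slicePoint {I : ℍ[ℝ]} (hI : I ∈ imagUnits) (z w : ℂ) :
    Commute (slicePoint I z) (slicePoint I w) := by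
  rw [← sliceHom_apply hI, ← sliceHom_apply hI]
  exact (Commute.all z w).map (sliceHom hI)

theorem exists_eq_slicePoint (q : ℍ[ℝ]) : ∃ I ∈ imagUnits, ∃ z : ℂ, q = slicePoint I z := by
  by_cases h : q.im = 0
  · refine ⟨(Complex.I : ℍ[ℝ]), ?_, (q.re : ℂ), ?_⟩
    · change (_ : ℍ[ℝ]) ^ 2 = -1
      rw [sq, ← Quaternion.coeComplex_mul, Complex.I_mul_I]
      ext <;> simp
    · rw [slicePoint_ofReal]
      conv_lhs => rw [← Quaternion.re_add_im q, h, add_zero]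
  · have hn : ‖q.im‖ ≠ 0 := norm_ne_zero_iff.2 h
    refine ⟨‖q.im‖⁻¹ • q.im, ?_, ⟨q.re, ‖q.im‖⟩, ?_⟩
    · change (_ : ℍ[ℝ]) ^ 2 = -1
      rw [smul_pow, Quaternion.sq_eq_neg_normSq.2 (by simp), Quaternion.normSq_eq_norm_mul_self,
        ← Quaternion.coe_neg, ← Quaternion.coe_smul, ← Quaternion.coe_one, ← Quaternion.coe_neg,
        smul_eq_mul]
      congr 1
      field_simp
    · rw [slicePoint, smul_mul_assoc, Quaternion.mul_coe_eq_smul, smul_smul, inv_mul_cancel₀ hn,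
        one_smul, Quaternion.re_add_im]

theorem sigma_slicePoint {I : ℍ[ℝ]} (hI : I ∈ imagUnits) (z w : ℂ) :
    sigma (slicePoint I z) (slicePoint I w) = ‖z - w‖ := by
  rw [sigma, if_pos ⟨I, hI, ⟨z, rfl⟩, ⟨w, rfl⟩⟩, ← sliceHom_apply hI, ← sliceHom_apply hI,
    ← map_sub, norm_sliceHom]

/-- This makes `‖p.im‖` a radius below which the σ-ball contains only points sharing a line with
`p`. -/
theorem norm_im_le_omega (q p : ℍ[ℝ]) : ‖p.im‖ ≤ omega q p := by
  refine Real.le_sqrt_of_sq_le ?_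
  nlinarith [sq_nonneg (q.re - p.re), norm_nonneg q.im, norm_nonneg p.im]

theorem im_slicePoint {I : ℍ[ℝ]} (hI : I ∈ imagUnits) (z : ℂ) :
    (slicePoint I z).im = z.im • I := by
  rw [slicePoint, Quaternion.mul_coe_eq_smul]
  ext <;> simp [re_of_mem hI]

/-- Two complex lines through a common nonreal point are equal. -/
theorem sliceLine_subset_of_slicePoint_eq {I J : ℍ[ℝ]} (hI : I ∈ imagUnits) (hJ : J ∈ imagUnits)
    {w w' : ℂ} (h : slicePoint J w' = slicePoint I w) (hw : w.im ≠ 0) :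
    sliceLine J ⊆ sliceLine I := by
  have him : w'.im • J = w.im • I := by rw [← im_slicePoint hJ, h, im_slicePoint hI]
  have hw' : w'.im ≠ 0 := by
    rintro h0
    rw [h0, zero_smul, eq_comm, smul_eq_zero_iff_right hw] at him
    simpa [him] using norm_of_mem hI
  rintro _ ⟨z, rfl⟩
  -- From `him`, `J` is the real multiple `w'.im⁻¹ * w.im` of `I`.
  refine ⟨⟨z.re, z.im * w'.im⁻¹ * w.im⟩, ?_⟩
  simp only [slicePoint, Quaternion.mul_coe_eq_smul]
  rw [mul_smul, ← him, smul_smul, mul_assoc, inv_mul_cancel₀ hw', mul_one]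

theorem isSigmaAnalyticAt_of_isSliceRegularOn {f : ℍ[ℝ] → ℍ[ℝ]} {Ω : Set ℍ[ℝ]}
    (hΩ : IsOpen Ω) (hf : IsSliceRegularOn f Ω) {p : ℍ[ℝ]} (hp : p ∈ Ω) :
    IsSigmaAnalyticAt f Ω p := by
  obtain ⟨I, hI, w, rfl⟩ := exists_eq_slicePoint p
  obtain ⟨R, hR, hball⟩ := Metric.isOpen_iff.1 hΩ _ hp
  obtain ⟨a, ha⟩ := exists_hasSum_of_isSliceRegularOn hf hI hball
  by_cases hw : w.im = 0
  · obtain ⟨c, rfl⟩ : ∃ c : ℝ, w = c := ⟨w.re, Complex.ext (by simp) (by simp [hw])⟩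
    refine ⟨a, R, hR, fun q hq => ?_⟩
    obtain ⟨J, hJ, z, rfl⟩ := exists_eq_slicePoint q
    have hIJ : slicePoint I c = slicePoint J c := by simp only [slicePoint_ofReal]
    -- The real centre also lies on `L_J`, so `f` has a second expansion there with the same radius.
    rw [hIJ] at hball hq ⊢
    obtain ⟨b, hb⟩ := exists_hasSum_of_isSliceRegularOn hf hJ hball
    have hreal : ∀ {K : ℍ[ℝ]} {d : ℕ → ℍ[ℝ]}, (∀ z ∈ Metric.ball (c : ℂ) R,
        HasSum (fun n => (slicePoint K z - slicePoint K c) ^ n * d n) (f (slicePoint K z))) →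
        ∀ x ∈ Metric.ball c R, Tendsto (fun N : ℕ => ∑ n ∈ Finset.range N, (x - c) ^ n • d n)
          atTop (𝓝 (f (x : ℍ[ℝ]))) := by
      intro K d hd x hx
      have hx' : (x : ℂ) ∈ Metric.ball (c : ℂ) R := by
        rw [mem_ball_iff_norm] at hx ⊢
        rwa [← Complex.ofReal_sub, Complex.norm_real]
      have := (hd x hx').tendsto_sum_nat
      simpa only [slicePoint_ofReal, ← Quaternion.coe_sub, ← Quaternion.coe_pow,
        Quaternion.coe_mul_eq_smul] using this
    have hab : a = b := coeff_eq_of_tendsto_real (g := fun x => f (x : ℍ[ℝ])) hR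
      (hreal ha) (hreal hb)
    have hz : z ∈ Metric.ball (c : ℂ) R := by
      rw [mem_ball_iff_norm, ← sigma_slicePoint hJ]
      exact hq.1
    simpa only [RegularSeriesConvergesTo, regularPow_eq_pow (commute_slicePoint hJ _ _), hab]
      using (hb z hz).tendsto_sum_nat
  · have him : 0 < ‖(slicePoint I w).im‖ := by
      rw [im_slicePoint hI, norm_smul, norm_of_mem hI, mul_one]
      exact norm_pos_iff.2 hw
    refine ⟨a, min R ‖(slicePoint I w).im‖, lt_min hR him, fun q hq => ?_⟩
    obtain ⟨hq, -⟩ := hq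
    have hline : SameLine q (slicePoint I w) := by
      by_contra hne
      have hlt : sigma q (slicePoint I w) < min R ‖(slicePoint I w).im‖ := hq
      rw [sigma, if_neg hne] at hlt
      exact absurd (hlt.trans_le (min_le_right _ _)) (norm_im_le_omega _ _).not_gt
    obtain ⟨J, hJ, hqJ, w', hw'⟩ := hline
    obtain ⟨z, rfl⟩ := sliceLine_subset_of_slicePoint_eq hI hJ hw' hw hqJ
    have hz : z ∈ Metric.ball w R := by
      rw [mem_ball_iff_norm, ← sigma_slicePoint hI]
      exact lt_of_lt_of_le hq (min_le_left _ _)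
    simpa only [RegularSeriesConvergesTo, regularPow_eq_pow (commute_slicePoint hI _ _)]
      using (ha z hz).tendsto_sum_nat

theorem isSliceRegularOn_of_isSigmaAnalyticOn {f : ℍ[ℝ] → ℍ[ℝ]} {Ω : Set ℍ[ℝ]}
    (hΩ : IsOpen Ω) (hf : IsSigmaAnalyticOn f Ω) : IsSliceRegularOn f Ω := by
  intro I hI w hw
  obtain ⟨a, R, hR, ha⟩ := hf _ hw
  obtain ⟨r, hr, hball⟩ := Metric.isOpen_iff.1 hΩ _ hw
  -- The bound `r` keeps the disc inside `Ω`, where alone the series is known to converge to `f`.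
  refine differentiableAt_slice_of_tendsto hI (lt_min hR hr) (a := a) fun z hz => ?_
  rw [mem_ball_iff_norm, lt_min_iff] at hz
  have hzΩ : slicePoint I z ∈ Ω := by
    refine hball ?_
    rw [mem_ball_iff_norm, ← sliceHom_apply hI, ← sliceHom_apply hI, ← map_sub, norm_sliceHom]
    exact hz.2
  have hzσ : slicePoint I z ∈ sigmaBall (slicePoint I w) R := by
    change sigma _ _ < R
    rw [sigma_slicePoint hI]
    exact hz.1
  simpa only [RegularSeriesConvergesTo, regularPow_eq_pow (commute_slicePoint hI _ _)]
    using ha _ ⟨hzσ, hzΩ⟩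

end SliceRegular

theorem mainTheorem1 (Ω : Set ℍ[ℝ]) (hΩ_open : IsOpen Ω) (hΩ_conn : IsConnected Ω)
    (f : ℍ[ℝ] → ℍ[ℝ]) :
    SliceRegular.IsSliceRegularOn f Ω ↔ SliceRegular.IsSigmaAnalyticOn f Ω :=
  ⟨fun hf _ hp => SliceRegular.isSigmaAnalyticAt_of_isSliceRegularOn hΩ_open hf hp,
    SliceRegular.isSliceRegularOn_of_isSigmaAnalyticOn hΩ_open⟩
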